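/- Work over the field $\mathbb{F}_2$. Let $\mathcal{E}$ be the category of all $\mathbb{F}_2$-vector spaces, $\mathcal{E}^f$ its full subcategory of finite dimensional spaces, and $\mathcal{F}$ the category of functors $\mathcal{E}^f \to \mathcal{E}$. Let $\mathcal{E}_q$ be the category of finite dimensional $\mathbb{F}_2$-vector spaces $V$ with a quadratic form $q$ that is non-degenerate (the bilinear form $B(x,y)=q(x+y)+q(x)+q(y)$ has zero radical), whose morphisms are the linear maps that preserve the forms. Such a morphism $f: V \to W$ is injective, and $W = f(V) \perp V' \simeq V \perp V'$ with $V' = f(V)^{\perp}$. For morphisms $f: V \to W \simeq V \perp V'$ and $g: V \to X \simeq V \perp V''$ of $\mathcal{E}_q$, their pseudo push-out is $W \perp_V X = V \perp V' \perp V''$, with the evident morphisms from $W$ and $X$. Let $\mathcal{T}_q$ be the category with the objects of $\mathcal{E}_q$ in which a morphism from $V$ to $W$ is a class $[V \to X \leftarrow W]$ of diagrams in $\mathcal{E}_q$ for the equivalence relation generated by: $(V \to X_1 \leftarrow W)$ is related to $(V \to X_2 \leftarrow W)$ if there is a morphism $\alpha: X_1 \to X_2$ of $\mathcal{E}_q$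 compatible with the maps from $V$ and from $W$. The composite of $[V \to X_1 \leftarrow W]$ and $[W \to X_2 \leftarrow Y]$ is $[V \to X_1 \perp_W X_2 \leftarrow Y]$. Let $\mathcal{F}_{quad}$ be the category of functors $\mathcal{T}_q \to \mathcal{E}$. Both $\mathcal{F}$ and $\mathcal{F}_{quad}$ are abelian categories, and symmetric monoidal under the pointwise tensor product over $\mathbb{F}_2$. Let $\epsilon: \mathcal{T}_q \to \mathcal{E}^f$ be the functor that sends $V$ to its underlying vector space and $[V \xrightarrow{f} X \xleftarrow{g} W]$ to $p_g \circ f$, where $p_g: X \simeq W \perp W' \to W$ is the orthogonal projection associated to $g$. **Theorem.** The functor $\iota: \mathcal{F} \to \mathcal{F}_{quad}$, $F \mapsto F \circ \epsilon$, given by precomposition with $\epsilon$, satisfies: 1. $\iota$ is exact (additive, and it preserves finite limits and finite colimits); 2. $\iota$ preserves tensor products: it is a strong symmetric monoidal functor whose structure isomorphisms $\iota(F) \otimes \iota(G) \simeq \iota(F \otimes G)$ and $\mathbb{1} \simeq \iota(\mathbb{1})$ are pointwise the identity maps; 3. $\iota$ is fully faithful; 4. if $S$ is a simple object of $\mathcal{F}$,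 then $\iota(S)$ is a simple object of $\mathcal{F}_{quad}$. -/

import Mathlib

open CategoryTheory QuadraticMap

namespace QuadFunctors

/-! ## Non-degenerate quadratic spaces over `𝔽₂` (the objects of `ℰ_q`) -/

/-- A finite dimensional `𝔽₂`-vector space with a quadratic form whose associated bilinear form
`B(v, w) = q(v + w) - q(v) - q(w)` has zero radical. The morphisms `V ⟶ W` of the category `ℰ_q`
of these spaces are the linear maps that preserve the forms, i.e. the elements of
`V.form →qᵢ W.form`. -/
structure QuadSpace : Type 1 where
  carrier : Type
  [addCommGroup : AddCommGroup carrier]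
  [module : Module (ZMod 2) carrier]
  [finite : Module.Finite (ZMod 2) carrier]
  form : QuadraticForm (ZMod 2) carrier
  nondeg : ∀ v : carrier, (∀ w : carrier, polar form v w = 0) → v = 0

namespace QuadSpace

instance : CoeSort QuadSpace (Type) := ⟨QuadSpace.carrier⟩

attribute [instance] QuadSpace.addCommGroup QuadSpace.module QuadSpace.finite

/-- The bilinear form associated to the quadratic form. -/
abbrev B (V : QuadSpace) : LinearMap.BilinForm (ZMod 2) V := V.form.polarBilin

lemma B_symm (V : QuadSpace) (v w : V) : V.B v w = V.B w v :=
  QuadraticMap.polar_comm _ _ _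

lemma nondegenerate (V : QuadSpace) : V.B.Nondegenerate :=
  ⟨fun v h => V.nondeg v h, fun v h => V.nondeg v fun w => (V.B_symm v w).trans (h w)⟩

lemma ext_of_B (V : QuadSpace) {x y : V} (h : ∀ w, V.B x w = V.B y w) : x = y :=
  sub_eq_zero.mp (V.nondeg _ fun w => by
    have := h w
    change V.B (x - y) w = 0
    rw [map_sub, LinearMap.sub_apply, this, sub_self])

end QuadSpace

open QuadSpace

lemma B_map {V W : QuadSpace} (f : V.form →qᵢ W.form) (x y : V) :
    W.B (f x) (f y) = V.B x y := by
  simp only [polarBilin_apply_apply, polar, ← map_add, Isometry.map_app]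

/-- The orthogonal projection `p_g : X → W` associated to a morphism `g : W → X` of `ℰ_q`,
where `X` is the orthogonal sum of `g(W) ≅ W` and of the orthogonal of `g(W)`. It is given here
as the adjoint of `g`; `proj_apply_map` and `proj_eq_zero_iff` identify it with the projection. -/
noncomputable def proj {W X : QuadSpace} (g : W.form →qᵢ X.form) : X →ₗ[ZMod 2] W :=
  (W.B.toDual W.nondegenerate).symm.toLinearMap ∘ₗ
    (X.B.compl₂ (g.toLinearMap : W →ₗ[ZMod 2] X))

lemma B_proj {W X : QuadSpace} (g : W.form →qᵢ X.form) (x : X) (w : W) :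
    W.B (proj g x) w = X.B x (g w) :=
  LinearMap.BilinForm.apply_toDual_symm_apply (hB := W.nondegenerate) _ _

/-- `p_g` is the identity on `W`. -/
lemma proj_apply_map {W X : QuadSpace} (g : W.form →qᵢ X.form) (w : W) :
    proj g (g w) = w :=
  W.ext_of_B fun w' => by rw [B_proj, B_map]

/-- The kernel of `p_g` is the orthogonal of `g(W)`. -/
lemma proj_eq_zero_iff {W X : QuadSpace} (g : W.form →qᵢ X.form) (x : X) :
    proj g x = 0 ↔ ∀ w, polar X.form x (g w) = 0 := by
  constructor
  · intro h w
    have := B_proj g x w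
    rw [h, map_zero, LinearMap.zero_apply] at this
    exact this.symm
  · intro h
    refine W.nondeg _ fun w => ?_
    change W.B (proj g x) w = 0
    rw [B_proj]
    exact h w

/-! ## The pseudo push-out -/

/-- The orthogonal `f(V)^⊥` of the image of `f : V → W`, as a subspace of `W`. -/
def orth {V W : QuadSpace} (f : V.form →qᵢ W.form) : Submodule (ZMod 2) W where
  carrier := {w | ∀ v : V, polar W.form w (f v) = 0}
  add_mem' {a b} ha hb v := by rw [polar_add_left, ha v, hb v, add_zero]
  zero_mem' v := polar_zero_left _ _
  smul_mem' c a ha v := by rw [polar_smul_left, ha v, smul_zero]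

lemma sub_proj_mem {V W : QuadSpace} (f : V.form →qᵢ W.form) (w : W) :
    w - f (proj f w) ∈ orth f := fun v => by
  change W.B (w - f (proj f w)) (f v) = 0
  rw [map_sub, LinearMap.sub_apply, B_map, B_proj, sub_self]

/-- The component of `w` in `f(V)^⊥`. -/
noncomputable def toOrth {V W : QuadSpace} (f : V.form →qᵢ W.form) :
    W →ₗ[ZMod 2] orth f :=
  (LinearMap.id - (f.toLinearMap : V →ₗ[ZMod 2] W) ∘ₗ proj f).codRestrict _ (sub_proj_mem f)

lemma coe_toOrth {V W : QuadSpace} (f : V.form →qᵢ W.form) (w : W) :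
    (toOrth f w : W) = w - f (proj f w) := rfl

lemma form_decomp {V W : QuadSpace} (f : V.form →qᵢ W.form) (w : W) :
    V.form (proj f w) + W.form (toOrth f w : W) = W.form w := by
  have h := (toOrth f w).2 (proj f w)
  have e : w = (toOrth f w : W) + f (proj f w) := by rw [coe_toOrth, sub_add_cancel]
  conv_rhs => rw [e]
  have := f.map_app (proj f w)
  rw [polar] at h
  linear_combination -h - this

/-- `f(V)^⊥` with the restriction of the quadratic form, the space `V'` in `W ≅ V ⊥ V'`. -/
abbrev orthSpace {V W : QuadSpace} (f : V.form →qᵢ W.form) : QuadSpace where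
  carrier := orth f
  form := W.form.comp (orth f).subtype
  nondeg := by
    rintro ⟨v, hv⟩ h
    refine Subtype.ext (W.nondeg v fun w => ?_)
    have h1 : W.B v (toOrth f w) = 0 := h (toOrth f w)
    have h2 : W.B v (f (proj f w)) = 0 := hv _
    change W.B v w = 0
    rw [coe_toOrth, map_sub, h2, sub_zero] at h1
    exact h1

/-- The orthogonal sum of two non-degenerate quadratic spaces. -/
abbrev orthSum (V W : QuadSpace) : QuadSpace where
  carrier := V × W
  form := V.form.prod W.form
  nondeg := by
    rintro ⟨v, w⟩ h
    refine Prod.ext (V.nondeg v fun v' => ?_) (W.nondeg w fun w' => ?_)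
    · simpa using h (v', 0)
    · simpa using h (0, w')

/-- The pseudo push-out `V ⊥ V' ⊥ V''` of `f : V → W ≅ V ⊥ V'` and `g : V → X ≅ V ⊥ V''`. -/
abbrev pseudoPushout {V W X : QuadSpace} (f : V.form →qᵢ W.form) (g : V.form →qᵢ X.form) :
    QuadSpace :=
  orthSum V (orthSum (orthSpace f) (orthSpace g))

variable {V W X : QuadSpace} (f : V.form →qᵢ W.form) (g : V.form →qᵢ X.form)

/-- The morphism `W ≅ V ⊥ V' → V ⊥ V' ⊥ V''`. -/
noncomputable def inlPP : W.form →qᵢ (pseudoPushout f g).form where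
  toLinearMap := (proj f).prod ((toOrth f).prod 0)
  map_app' w := by simpa using form_decomp f w

/-- The morphism `X ≅ V ⊥ V'' → V ⊥ V' ⊥ V''`. -/
noncomputable def inrPP : X.form →qᵢ (pseudoPushout f g).form where
  toLinearMap := (proj g).prod (LinearMap.prod 0 (toOrth g))
  map_app' x := by simpa using form_decomp g x

lemma inlPP_apply (w : W) : inlPP f g w = (proj f w, toOrth f w, 0) := rfl

lemma inrPP_apply (x : X) : inrPP f g x = (proj g x, 0, toOrth g x) := rfl

lemma toOrth_map (v : V) : toOrth f (f v) = 0 :=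
  Subtype.ext (by rw [coe_toOrth, proj_apply_map, sub_self]; rfl)

lemma PP_comm (v : V) : inlPP f g (f v) = inrPP f g (g v) := by
  rw [inlPP_apply, inrPP_apply, toOrth_map, toOrth_map, proj_apply_map, proj_apply_map]

/-- The images of `W` and `X` in a space `Z` that completes a commutative square with `f` and
`g` are "orthogonal over `V`". -/
structure Glues {Z : QuadSpace} (k : W.form →qᵢ Z.form) (l : X.form →qᵢ Z.form) : Prop where
  comm : ∀ v, k (f v) = l (g v)
  ortho : ∀ w x, Z.B (k w) (l x) = V.B (proj f w) (proj g x)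

lemma PP_glues : Glues f g (inlPP f g) (inrPP f g) where
  comm := PP_comm f g
  ortho w x := by
    rw [inlPP_apply, inrPP_apply]
    simp [polarBilin_apply_apply]

variable {f g}

/-- The pseudo push-out maps to every square over `V` which is orthogonal over `V`. -/
lemma Glues.lift {Z : QuadSpace} {k : W.form →qᵢ Z.form} {l : X.form →qᵢ Z.form}
    (h : Glues f g k l) : ∃ a : (pseudoPushout f g).form →qᵢ Z.form,
      (∀ w, a (inlPP f g w) = k w) ∧ ∀ x, a (inrPP f g x) = l x := by
  have hk (w : orth f) : proj f (w : W) = 0 := (proj_eq_zero_iff f _).2 w.2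
  have hl (x : orth g) : proj g (x : X) = 0 := (proj_eq_zero_iff g _).2 x.2
  let a : (V × orth f × orth g) →ₗ[ZMod 2] Z :=
    ((k.toLinearMap : W →ₗ[ZMod 2] Z) ∘ₗ (f.toLinearMap : V →ₗ[ZMod 2] W)).coprod
      (((k.toLinearMap : W →ₗ[ZMod 2] Z) ∘ₗ (orth f).subtype).coprod
        ((l.toLinearMap : X →ₗ[ZMod 2] Z) ∘ₗ (orth g).subtype))
  have ha (v : V) (w : orth f) (x : orth g) : a (v, w, x) = k (f v) + (k w + l x) := rfl
  refine ⟨⟨a, ?_⟩, fun w => ?_, fun x => ?_⟩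
  · rintro ⟨v, w, x⟩
    change Z.form (a (v, w, x)) = V.form v + (W.form w + X.form x)
    have h1 : Z.form (k w + l x) = W.form w + X.form x := by
      have := h.ortho (w : W) (x : X)
      rw [hk, map_zero, LinearMap.zero_apply, polarBilin_apply_apply, polar] at this
      rw [← k.map_app, ← l.map_app]
      linear_combination this
    have h2 : Z.B (k (f v)) (k w + l x) = 0 := by
      rw [map_add, B_map, h.comm, B_map, W.B_symm, X.B_symm, ← B_proj, ← B_proj, hk, hl]
      simp
    rw [ha, ← h1, ← f.map_app, ← k.map_app]
    rw [polarBilin_apply_apply, polar] at h2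
    linear_combination h2
  · change a (proj f w, toOrth f w, 0) = _
    rw [ha, coe_toOrth]; simp
  · change a (proj g x, 0, toOrth g x) = _
    rw [ha, coe_toOrth, h.comm]; simp

/-! ## The category `𝒯_q` -/

/-- Diagrams `V → X ← W` of `ℰ_q`. -/
structure Cospan (V W : QuadSpace) : Type 1 where
  apex : QuadSpace
  left : V.form →qᵢ apex.form
  right : W.form →qᵢ apex.form

/-- The relation `ℛ`: there is a morphism `α` of `ℰ_q` between the middle objects that is
compatible with the two legs. Isomorphic diagrams are related in particular. -/
def Cospan.Rel {V W : QuadSpace} (S T : Cospan V W) : Prop :=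
  ∃ α : S.apex.form →qᵢ T.apex.form, α.comp S.left = T.left ∧ α.comp S.right = T.right

/-- The morphisms of `𝒯_q`: classes of diagrams for the equivalence relation generated by `ℛ`.
(Since isomorphic diagrams are related by `ℛ`, taking isomorphism classes of diagrams first
would not change this quotient.) -/
def TqHom (V W : QuadSpace) : Type 1 :=
  Quot (Cospan.Rel (V := V) (W := W))

/-- The class `[V → X ← W]`. -/
def TqHom.mk {V W : QuadSpace} (S : Cospan V W) : TqHom V W := Quot.mk _ S

lemma TqHom.sound {V W : QuadSpace} {S T : Cospan V W} (h : S.Rel T) :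
    TqHom.mk S = TqHom.mk T := Quot.sound h

/-- The diagram `V → V ← V` of identities. -/
abbrev Cospan.id (V : QuadSpace) : Cospan V V := ⟨V, .id _, .id _⟩

/-- The composite `V → X₁ ⊥_W X₂ ← Y` of `S : V → X₁ ← W` and `T : W → X₂ ← Y`. -/
noncomputable abbrev Cospan.comp {V W Y : QuadSpace} (S : Cospan V W) (T : Cospan W Y) :
    Cospan V Y where
  apex := pseudoPushout S.right T.left
  left := (inlPP S.right T.left).comp S.left
  right := (inrPP S.right T.left).comp T.right

lemma Cospan.comp_rel {V W Y : QuadSpace} (S : Cospan V W) (T : Cospan W Y)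
    {R : Cospan V Y} {k : S.apex.form →qᵢ R.apex.form} {l : T.apex.form →qᵢ R.apex.form}
    (h : Glues S.right T.left k l) (hk : ∀ v, k (S.left v) = R.left v)
    (hl : ∀ y, l (T.right y) = R.right y) : (S.comp T).Rel R := by
  obtain ⟨a, h1, h2⟩ := h.lift
  exact ⟨a, Isometry.ext fun v => (h1 _).trans (hk v), Isometry.ext fun y => (h2 _).trans (hl y)⟩

/-- `p_{α ∘ g} ∘ α = p_g`. -/
lemma proj_comp_map {W X Y : QuadSpace} (g : W.form →qᵢ X.form) (α : X.form →qᵢ Y.form)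
    (x : X) : proj (α.comp g) (α x) = proj g x :=
  W.ext_of_B fun w => by rw [B_proj, B_proj, Isometry.comp_apply, B_map]

/-- `p_{α ∘ g} = p_g ∘ p_α`. -/
lemma proj_comp {W X Y : QuadSpace} (g : W.form →qᵢ X.form) (α : X.form →qᵢ Y.form)
    (y : Y) : proj (α.comp g) y = proj g (proj α y) :=
  W.ext_of_B fun w => by rw [B_proj, B_proj, B_proj, Isometry.comp_apply]

lemma proj_id (V : QuadSpace) (v : V) : proj (Isometry.id V.form) v = v :=
  proj_apply_map (Isometry.id V.form) v

/-- In a square which is orthogonal over `V`, one has `p_l ∘ k = g ∘ p_f`. -/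
lemma Glues.proj_right {V W X Z : QuadSpace} {f : V.form →qᵢ W.form} {g : V.form →qᵢ X.form}
    {k : W.form →qᵢ Z.form} {l : X.form →qᵢ Z.form} (h : Glues f g k l) (w : W) :
    proj l (k w) = g (proj f w) :=
  X.ext_of_B fun x => by
    rw [B_proj, h.ortho, X.B_symm, ← B_proj, V.B_symm]

lemma Glues.proj_left {V W X Z : QuadSpace} {f : V.form →qᵢ W.form} {g : V.form →qᵢ X.form}
    {k : W.form →qᵢ Z.form} {l : X.form →qᵢ Z.form} (h : Glues f g k l) (x : X) :
    proj k (l x) = f (proj g x) :=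
  W.ext_of_B fun w => by
    rw [B_proj, Z.B_symm, h.ortho, W.B_symm, ← B_proj]

lemma Cospan.comp_rel_left {V W Y : QuadSpace} {S S' : Cospan V W} (h : S.Rel S')
    (T : Cospan W Y) : (S.comp T).Rel (S'.comp T) := by
  obtain ⟨α, h1, h2⟩ := h
  have G := PP_glues S'.right T.left
  refine comp_rel S T (k := (inlPP S'.right T.left).comp α) (l := inrPP S'.right T.left)
    ⟨fun v => ?_, fun w x => ?_⟩ (fun v => ?_) (fun y => rfl)
  · rw [← G.comm]
    exact congrArg (inlPP S'.right T.left) (DFunLike.congr_fun h2 v)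
  · rw [Isometry.comp_apply, G.ortho]
    congr 2
    rw [← h2, proj_comp_map]
  · change _ = inlPP S'.right T.left (S'.left v)
    rw [← h1]; rfl

lemma Cospan.comp_rel_right {V W Y : QuadSpace} (S : Cospan V W)
    {T T' : Cospan W Y} (h : T.Rel T') : (S.comp T).Rel (S.comp T') := by
  obtain ⟨α, h1, h2⟩ := h
  have G := PP_glues S.right T'.left
  refine comp_rel S T (k := inlPP S.right T'.left) (l := (inrPP S.right T'.left).comp α)
    ⟨fun v => ?_, fun w x => ?_⟩ (fun v => rfl) (fun y => ?_)
  · rw [G.comm]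
    exact congrArg (inrPP S.right T'.left) (DFunLike.congr_fun h1 v).symm
  · rw [Isometry.comp_apply, G.ortho]
    congr 1
    rw [← h1, proj_comp_map]
  · change _ = inrPP S.right T'.left (T'.right y)
    rw [← h2]; rfl

/-- Composition of morphisms of `𝒯_q`, in diagrammatic order. -/
noncomputable def TqHom.comp {V W Y : QuadSpace} : TqHom V W → TqHom W Y → TqHom V Y :=
  Quot.map₂ Cospan.comp (fun S _ _ h => Cospan.comp_rel_right S h)
    (fun _ _ T h => Cospan.comp_rel_left h T)

lemma Cospan.id_comp_rel {V W : QuadSpace} (S : Cospan V W) : ((id V).comp S).Rel S :=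
  comp_rel (id V) S (k := S.left) (l := .id _)
    ⟨fun _ => rfl, fun (v : V) x => by
      change S.apex.B (S.left v) x = V.B (proj (Isometry.id V.form) v) _
      rw [proj_id, V.B_symm, B_proj, QuadSpace.B_symm]⟩ (fun _ => rfl) (fun _ => rfl)

lemma Cospan.comp_id_rel {V W : QuadSpace} (S : Cospan V W) : (S.comp (id W)).Rel S :=
  comp_rel S (id W) (k := .id _) (l := S.right)
    ⟨fun _ => rfl, fun x (w : W) => by
      change S.apex.B x (S.right w) = W.B _ (proj (Isometry.id W.form) w)
      rw [proj_id, B_proj]⟩ (fun _ => rfl) (fun _ => rfl)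

lemma Cospan.assoc_rel {U V W Y : QuadSpace} (S : Cospan U V) (T : Cospan V W)
    (R : Cospan W Y) : ((S.comp T).comp R).Rel (S.comp (T.comp R)) := by
  have G1 := PP_glues S.right T.left
  have G2 := PP_glues T.right R.left
  have G3 := PP_glues S.right (T.comp R).left
  have hGl : Glues S.right T.left (inlPP S.right (T.comp R).left)
      ((inrPP S.right (T.comp R).left).comp (inlPP T.right R.left)) := by
    refine ⟨fun v => G3.comm v, fun w x => ?_⟩
    rw [Isometry.comp_apply, G3.ortho]
    congr 1
    exact proj_comp_map T.left (inlPP T.right R.left) x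
  obtain ⟨a, h1, h2⟩ := hGl.lift
  refine comp_rel (S.comp T) R (k := a)
    (l := (inrPP S.right (T.comp R).left).comp (inrPP T.right R.left))
    ⟨fun w => ?_, fun z r => ?_⟩ (fun u => h1 _) (fun y => rfl)
  · refine (h2 _).trans ?_
    rw [Isometry.comp_apply, Isometry.comp_apply, G2.comm]
  · -- every `z` is a sum of an element coming from `S.apex` and one coming from `T.apex`
    obtain ⟨s, t, rfl⟩ : ∃ s t, z = inlPP S.right T.left s + inrPP S.right T.left t := by
      obtain ⟨v, s, t⟩ := z
      refine ⟨s, T.left v + t, ?_⟩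
      have hs : proj S.right (s : S.apex) = 0 := (proj_eq_zero_iff _ _).2 s.2
      have ht : proj T.left (t : T.apex) = 0 := (proj_eq_zero_iff _ _).2 t.2
      have hs' : toOrth S.right (s : S.apex) = s :=
        Subtype.ext (by rw [coe_toOrth, hs, map_zero, sub_zero])
      have ht' : toOrth T.left (t : T.apex) = t :=
        Subtype.ext (by rw [coe_toOrth, ht, map_zero, sub_zero])
      rw [inlPP_apply, inrPP_apply, map_add, map_add, toOrth_map, proj_apply_map, hs, ht, hs', ht']
      simp
    have hp (z) : proj (S.comp T).right z = proj T.right (proj (inrPP S.right T.left) z) :=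
      proj_comp T.right (inrPP S.right T.left) z
    have hz : a (inlPP S.right T.left s + inrPP S.right T.left t) =
        inlPP S.right (T.comp R).left s +
          inrPP S.right (T.comp R).left (inlPP T.right R.left t) := by
      rw [map_add, h1, h2]; rfl
    rw [hz, hp, map_add, map_add (proj _), map_add (proj T.right), map_add (W.B),
      LinearMap.add_apply, LinearMap.add_apply, G1.proj_right, proj_apply_map,
      Isometry.comp_apply, B_map, G2.ortho, G3.ortho]
    congr 1
    have : proj (T.comp R).left (inrPP T.right R.left r) =
        proj T.left (T.right (proj R.left r)) := by
      rw [← G2.proj_left r]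
      exact proj_comp T.left (inlPP T.right R.left) _
    rw [this, QuadSpace.B_symm, B_proj, QuadSpace.B_symm, ← B_proj]

/-- The category `𝒯_q`, with the same objects as `ℰ_q`. -/
structure Tq : Type 1 where
  space : QuadSpace

noncomputable instance : Category.{1} Tq where
  Hom V W := TqHom V.space W.space
  id V := TqHom.mk (Cospan.id V.space)
  comp S T := TqHom.comp S T
  id_comp := by
    rintro V W ⟨S⟩
    exact TqHom.sound S.id_comp_rel
  comp_id := by
    rintro V W ⟨S⟩
    exact TqHom.sound S.comp_id_rel
  assoc := by
    rintro U V W Y ⟨S⟩ ⟨T⟩ ⟨R⟩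
    exact TqHom.sound (Cospan.assoc_rel S T R)

/-! ## The forgetful functor `ε` and the functor categories -/

/-- The linear map `p_g ∘ f` attached to a diagram `V → X ← W` with legs `f` and `g`. -/
noncomputable def Cospan.toLinear {V W : QuadSpace} (S : Cospan V W) : V →ₗ[ZMod 2] W :=
  proj S.right ∘ₗ (S.left.toLinearMap : V →ₗ[ZMod 2] S.apex)

lemma Cospan.toLinear_eq {V W : QuadSpace} {S T : Cospan V W} (h : S.Rel T) :
    S.toLinear = T.toLinear := by
  obtain ⟨α, h1, h2⟩ := h
  refine LinearMap.ext fun v => ?_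
  change proj S.right (S.left v) = proj T.right (T.left v)
  rw [← h1, ← h2, Isometry.comp_apply, proj_comp_map]

/-- The value of `ε` on morphisms: `[V → X ← W] ↦ p_g ∘ f`. -/
noncomputable def TqHom.toLinear {V W : QuadSpace} : TqHom V W → (V →ₗ[ZMod 2] W) :=
  Quot.lift Cospan.toLinear fun _ _ => Cospan.toLinear_eq

lemma TqHom.toLinear_comp {V W Y : QuadSpace} (S : TqHom V W) (T : TqHom W Y) :
    (S.comp T).toLinear = T.toLinear ∘ₗ S.toLinear := by
  obtain ⟨S⟩ := S
  obtain ⟨T⟩ := T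
  refine LinearMap.ext fun v => ?_
  change proj ((inrPP S.right T.left).comp T.right) (inlPP S.right T.left (S.left v)) =
    proj T.right (T.left (proj S.right (S.left v)))
  rw [proj_comp, (PP_glues S.right T.left).proj_right]

/-- The category `ℰ` of all `𝔽₂`-vector spaces. -/
abbrev Vect : Type 1 := ModuleCat (ZMod 2)

/-- The category `ℰ^f` of finite dimensional `𝔽₂`-vector spaces. -/
abbrev FinVect : Type 1 := FGModuleCat (ZMod 2)

/-- The forgetful functor `ε : 𝒯_q ⥤ ℰ^f`. -/
noncomputable def forgetful : Tq ⥤ FinVect where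
  obj V := FGModuleCat.of (ZMod 2) V.space
  map S := FGModuleCat.ofHom (TqHom.toLinear S)
  map_id V := by
    apply FGModuleCat.hom_ext
    exact LinearMap.ext fun v => proj_id V.space v
  map_comp S T := by
    apply FGModuleCat.hom_ext
    exact TqHom.toLinear_comp S T

/-- The category `ℱ` of functors from `ℰ^f` to `ℰ`. -/
abbrev FunctorF : Type 1 := FinVect ⥤ Vect

/-- The category `ℱ_quad` of functors from `𝒯_q` to `ℰ`. -/
abbrev FunctorFquad : Type 1 := Tq ⥤ Vect

/-- The functor `ι : ℱ ⥤ ℱ_quad`, precomposition with `ε`. -/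
noncomputable def iota : FunctorF ⥤ FunctorFquad :=
  (Functor.whiskeringLeft Tq FinVect Vect).obj forgetful

end QuadFunctors

namespace QuadFunctors

/-! ## The functor `ε` is full, and every object of `ℰ^f` is a retract of a value of `ε` -/

/-! Exactness and compatibility with tensor products are pointwise facts. The rest follows from two
properties of `ε`. It is full (`TqHom.toLinear_surjective`): a linear map `f` need not preserve
forms, but adding a non-degenerate summand whose form absorbs the defect turns it into an isometry,
and projecting that summand away recovers `f`. It is not essentially surjective, since the spaces in
`𝒯_q` have even dimension, but every `V` is a retract of `V × V*`, which does carry a non-degenerate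
form.

A natural transformation on `ℰ^f` is thus determined by its components on values of `ε`, and
fullness lets every family natural over `𝒯_q` extend. For simplicity, fullness makes each subobject
of `ι(S)` the restriction of a subfunctor of `S` (`range_coinducedι_app`), which simplicity of `S`
forces to be zero or everything. -/

/-- The quadratic form `(v, φ) ↦ q v + φ v` on `V × V*`; it restricts to `q` on `V` and is
non-degenerate whatever `q` is. -/
noncomputable def hyperbolicForm {V : Type} [AddCommGroup V] [Module (ZMod 2) V]
    (q : QuadraticForm (ZMod 2) V) : QuadraticForm (ZMod 2) (V × Module.Dual (ZMod 2) V) :=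
  q.comp (LinearMap.fst _ _ _) +
    LinearMap.BilinMap.toQuadraticMap
      ((LinearMap.id (R := ZMod 2) (M := Module.Dual (ZMod 2) V)).compl₁₂
        (LinearMap.snd _ _ _) (LinearMap.fst _ _ _))

lemma hyperbolicForm_apply {V : Type} [AddCommGroup V] [Module (ZMod 2) V]
    (q : QuadraticForm (ZMod 2) V) (v : V) (φ : Module.Dual (ZMod 2) V) :
    hyperbolicForm q (v, φ) = q v + φ v := by
  simp [hyperbolicForm]

lemma polar_hyperbolicForm {V : Type} [AddCommGroup V] [Module (ZMod 2) V]
    (q : QuadraticForm (ZMod 2) V) (v w : V) (φ ψ : Module.Dual (ZMod 2) V) :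
    polar (hyperbolicForm q) (v, φ) (w, ψ) = polar q v w + φ w + ψ v := by
  simp only [polar, Prod.mk_add_mk, hyperbolicForm_apply, LinearMap.add_apply, map_add]
  ring

/-- The non-degenerate quadratic space `V × V*` attached to a quadratic form on `V`. -/
noncomputable def hyperbolicSpace {V : Type} [AddCommGroup V] [Module (ZMod 2) V]
    [Module.Finite (ZMod 2) V] (q : QuadraticForm (ZMod 2) V) : QuadSpace where
  carrier := V × Module.Dual (ZMod 2) V
  form := hyperbolicForm q
  nondeg := by
    rintro ⟨v, φ⟩ h
    have hv : v = 0 := (Module.forall_dual_apply_eq_zero_iff (ZMod 2) v).1 fun ψ => by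
      simpa [polar_hyperbolicForm] using h (0, ψ)
    subst hv
    have hφ : φ = 0 := LinearMap.ext fun w => by
      simpa [polar_hyperbolicForm] using h (w, 0)
    rw [hφ]; rfl

/-- Every linear map between non-degenerate quadratic spaces comes from a diagram of `ℰ_q`. -/
lemma TqHom.toLinear_surjective {V W : QuadSpace} (f : V →ₗ[ZMod 2] W) :
    ∃ S : TqHom V W, S.toLinear = f := by
  -- The form `q_V - q_W ∘ f` is the defect of `f` from being an isometry, so `v ↦ (f v, (v, 0))`
  -- preserves the forms.
  let Y := hyperbolicSpace (V.form - W.form.comp f)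
  let left : V.form →qᵢ (orthSum W Y).form :=
    { toLinearMap := f.prod (LinearMap.inl (ZMod 2) V (Module.Dual (ZMod 2) V))
      map_app' v := by
        change W.form (f v) + hyperbolicForm _ (v, 0) = _
        rw [hyperbolicForm_apply]
        simp }
  let right : W.form →qᵢ (orthSum W Y).form :=
    { toLinearMap := LinearMap.inl (ZMod 2) W Y
      map_app' w := by
        change W.form w + Y.form 0 = _
        simp }
  refine ⟨.mk ⟨orthSum W Y, left, right⟩, LinearMap.ext fun v => W.ext_of_B fun w => ?_⟩
  refine (B_proj right (left v) w).trans ?_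
  change polar (W.form.prod Y.form) (f v, ((v, 0) : Y)) (w, 0) = _
  rw [QuadraticMap.polar_prod]
  exact (congrArg _ (polar_zero_right Y.form _)).trans (add_zero _)

instance forgetful_full : forgetful.Full where
  map_surjective {V W} f := by
    obtain ⟨S, hS⟩ := TqHom.toLinear_surjective f.hom.hom
    refine ⟨S, FGModuleCat.hom_ext hS⟩

/-- Every finite dimensional vector space is a retract of the underlying space of a
non-degenerate quadratic space. -/
lemma exists_retract_forgetful (V : FinVect) : ∃ A : Tq, Nonempty (Retract V (forgetful.obj A)) :=
  -- Only the underlying space matters here, so any form on `V` would do.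
  ⟨⟨hyperbolicSpace (V := V) 0⟩, ⟨{
    i := FGModuleCat.ofHom (LinearMap.inl (ZMod 2) V (Module.Dual (ZMod 2) V))
    r := FGModuleCat.ofHom (LinearMap.fst (ZMod 2) V (Module.Dual (ZMod 2) V))
    retract := rfl }⟩⟩

/-! ## Precomposition with a full functor that reaches every object up to retracts -/

section Precomposition

universe v₁ v₂ v₃ u₁ u₂ u₃

variable {C : Type u₁} [Category.{v₁} C] {D : Type u₂} [Category.{v₂} D]
  {E : Type u₃} [Category.{v₃} E] (L : C ⥤ D)

/-- Naturality along a retraction recovers the component at `d` from the one at `L.obj c`. -/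
lemma whiskeringLeft_faithful_of_retract (h : ∀ d, ∃ c, Nonempty (Retract d (L.obj c))) :
    ((Functor.whiskeringLeft C D E).obj L).Faithful where
  map_injective {F G} σ τ hστ := by
    ext d
    obtain ⟨c, ⟨r⟩⟩ := h d
    have hc : σ.app (L.obj c) = τ.app (L.obj c) := congr_app hστ c
    have e (ρ : F ⟶ G) : ρ.app d = F.map r.i ≫ ρ.app (L.obj c) ≫ G.map r.r := by
      rw [← ρ.naturality, ← F.map_comp_assoc, r.retract, F.map_id, Category.id_comp]
    rw [e σ, e τ, hc]

/-- The retract formula that proves faithfulness dictates the extension. Fullness of `L` makes `σ`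
natural for all morphisms between values of `L`, which is what naturality of the extension needs. -/
lemma whiskeringLeft_full_of_retract [L.Full]
    (h : ∀ d, ∃ c, Nonempty (Retract d (L.obj c))) :
    ((Functor.whiskeringLeft C D E).obj L).Full where
  map_surjective {F G} σ := by
    choose c r using h
    replace r (d) := (r d).some
    have nat {a b : C} (f : L.obj a ⟶ L.obj b) : F.map f ≫ σ.app b = σ.app a ≫ G.map f := by
      obtain ⟨g, rfl⟩ := L.map_surjective f
      exact σ.naturality g
    refine ⟨{ app := fun d => F.map (r d).i ≫ σ.app (c d) ≫ G.map (r d).r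
              naturality := fun d e f => ?_ }, ?_⟩
    -- Replacing `f` by `r ≫ f ≫ i` gives a morphism between values of `L`, to which `nat` applies.
    · have h1 : F.map f ≫ F.map (r e).i =
          F.map (r d).i ≫ F.map ((r d).r ≫ f ≫ (r e).i) := by
        rw [← F.map_comp, ← F.map_comp, (r d).retract_assoc]
      rw [← Category.assoc, h1, Category.assoc, reassoc_of% (nat ((r d).r ≫ f ≫ (r e).i))]
      simp only [Category.assoc, ← G.map_comp, (r e).retract, Category.comp_id]
    -- The retract chosen for `L.obj a` need not be the trivial one; `nat` along its inclusion
    -- cancels it.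
    · ext a
      change F.map (r (L.obj a)).i ≫ σ.app _ ≫ G.map (r (L.obj a)).r = σ.app a
      rw [reassoc_of% (nat (a := a) (r (L.obj a)).i), ← G.map_comp, (r _).retract, G.map_id]
      exact Category.comp_id _

/-- Precomposition with `L`, as a strong symmetric monoidal functor for the pointwise tensor
products, with the identities as structure morphisms. -/
abbrev whiskeringLeftBraided [MonoidalCategory E] [BraidedCategory E] :
    ((Functor.whiskeringLeft C D E).obj L).Braided where
  ε := { app := fun _ => 𝟙 _ }
  μ _ _ := { app := fun _ => 𝟙 _ }
  η := { app := fun _ => 𝟙 _ }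
  δ _ _ := { app := fun _ => 𝟙 _ }
  braided _ _ := by
    ext c : 2
    exact (Category.id_comp _).trans (Category.comp_id _).symm

end Precomposition

/-! ## Simple functors -/

section Simple

universe v₁ v₂ u₁ u₂ u w

variable {C : Type u₁} [Category.{v₁} C] {D : Type u₂} [Category.{v₂} D]
  {R : Type u} [Ring R] (L : C ⥤ D)

/-- For a morphism `i : T ⟶ L ⋙ S`, the largest subfunctor of `S` whose values on the objects
`L.obj c` are contained in the image of `i`. -/
def coinduced {S : D ⥤ ModuleCat.{w} R} {T : C ⥤ ModuleCat.{w} R} (i : T ⟶ L ⋙ S) :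
    D ⥤ ModuleCat.{w} R where
  obj d := ModuleCat.of R
    (⨅ (c : C) (f : d ⟶ L.obj c), (LinearMap.range (i.app c).hom).comap (S.map f).hom :
      Submodule R (S.obj d))
  map {d e} g := ModuleCat.ofHom <| (S.map g).hom.restrict fun x hx => by
    simp only [Submodule.mem_iInf, Submodule.mem_comap] at hx ⊢
    intro c f
    simpa using hx c (g ≫ f)
  map_id d := by
    ext x
    exact (congrArg (fun h => h.hom x.1) (S.map_id d))
  map_comp f g := by
    ext x
    exact (congrArg (fun h => h.hom x.1) (S.map_comp f g))

/-- The inclusion of `coinduced L i` in `S`. -/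
def coinducedι {S : D ⥤ ModuleCat.{w} R} {T : C ⥤ ModuleCat.{w} R} (i : T ⟶ L ⋙ S) :
    coinduced L i ⟶ S where
  app d := ModuleCat.ofHom (Submodule.subtype _)

instance {S : D ⥤ ModuleCat.{w} R} {T : C ⥤ ModuleCat.{w} R} (i : T ⟶ L ⋙ S) :
    Mono (coinducedι L i) := by
  rw [NatTrans.mono_iff_mono_app]
  exact fun d => (ModuleCat.mono_iff_injective _).2 Subtype.val_injective

/-- The identity of `L.obj c` gives one inclusion. For the other, fullness writes each `L.obj c ⟶
L.obj c'` as `L.map g`, and naturality of `i` shows that `S` carries image into image. -/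
lemma range_coinducedι_app {S : D ⥤ ModuleCat.{w} R} {T : C ⥤ ModuleCat.{w} R} [L.Full]
    (i : T ⟶ L ⋙ S) (c : C) :
    LinearMap.range ((coinducedι L i).app (L.obj c)).hom = LinearMap.range (i.app c).hom := by
  refine (Submodule.range_subtype _).trans (le_antisymm (fun x hx => ?_) (fun x hx => ?_))
  · simp only [Submodule.mem_iInf, Submodule.mem_comap] at hx
    simpa using hx c (𝟙 _)
  · simp only [Submodule.mem_iInf, Submodule.mem_comap]
    intro c' f
    obtain ⟨g, rfl⟩ := L.map_surjective f
    obtain ⟨t, rfl⟩ := hx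
    exact ⟨(T.map g).hom t, congr($(i.naturality g).hom t)⟩

/-- Precomposition with a full functor preserves simple functors, as soon as it is faithful. -/
lemma simple_whiskeringLeft_obj [L.Full]
    [((Functor.whiskeringLeft C D (ModuleCat.{w} R)).obj L).Faithful]
    (S : D ⥤ ModuleCat.{w} R) [Simple S] :
    Simple (((Functor.whiskeringLeft C D (ModuleCat.{w} R)).obj L).obj S) where
  mono_isIso_iff_nonzero {T} i _ := by
    constructor
    -- If `0` is an isomorphism onto the restriction of `S`, the identity of that restriction is
    -- zero, hence by faithfulness so is that of `S`.
    · rintro hi rfl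
      refine id_nonzero S (((Functor.whiskeringLeft C D (ModuleCat.{w} R)).obj L).map_injective ?_)
      rw [← cancel_epi (0 : T ⟶ _)]
      rw [Limits.zero_comp]
      exact Limits.zero_comp.symm
    · intro hi
      have hι : coinducedι L i ≠ 0 := fun h => hi <| by
        ext c x
        have h1 : (i.app c).hom x ∈ LinearMap.range ((coinducedι L i).app (L.obj c)).hom := by
          rw [range_coinducedι_app]
          exact ⟨x, rfl⟩
        obtain ⟨y, hy⟩ := h1
        rw [h] at hy
        exact hy.symm
      -- By simplicity the subfunctor is all of `S`, so its values at `L.obj c`, the images of `i`,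
      -- are everything.
      have := isIso_of_mono_of_nonzero hι
      rw [NatTrans.isIso_iff_isIso_app]
      intro c
      have hm : Mono (i.app c) := inferInstance
      have he : Epi (i.app c) := by
        rw [ModuleCat.epi_iff_range_eq_top]
        refine (range_coinducedι_app L i c).symm.trans ?_
        exact (ModuleCat.epi_iff_range_eq_top _).1 inferInstance
      exact isIso_of_mono_of_epi _

end Simple

end QuadFunctors
open QuadFunctors MonoidalCategory in
theorem theorem3p1 :
    -- `ι` is an exact functor between abelian categories
    (iota.Additive ∧ exactFunctor FunctorF FunctorFquad iota) ∧
    -- `ι` is a (strong, symmetric) monoidal functor for the pointwise tensor products,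
    -- with the identity maps as structure morphisms
    (∃ b : iota.Braided,
      (∀ (V : Tq), b.ε.app V = 𝟙 (𝟙_ Vect)) ∧
      ∀ (F G : FunctorF) (V : Tq),
        (b.μ F G).app V = 𝟙 (F.obj (forgetful.obj V) ⊗ G.obj (forgetful.obj V))) ∧
    -- `ι` is fully faithful
    (iota.Full ∧ iota.Faithful) ∧
    -- `ι` preserves simple objects
    (∀ S : FunctorF, Simple S → Simple (iota.obj S)) := by
  have hfull : iota.Full := whiskeringLeft_full_of_retract _ exists_retract_forgetful
  have hfaithful : iota.Faithful := whiskeringLeft_faithful_of_retract _ exists_retract_forgetful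
  refine ⟨⟨{}, ?_, ?_⟩, ⟨whiskeringLeftBraided forgetful, fun _ => rfl, fun _ _ _ => rfl⟩,
    ⟨hfull, hfaithful⟩, fun S _ => ?_⟩
  -- Limits and colimits of functors to `ℰ` are computed pointwise, so precomposition preserves
  -- them.
  · exact ⟨fun J _ _ => whiskeringLeft_preservesLimitsOfShape J forgetful⟩
  · exact ⟨fun J _ _ => whiskeringLeft_preservesColimitsOfShape J forgetful⟩
  · have : ((Functor.whiskeringLeft Tq FinVect Vect).obj forgetful).Faithful := hfaithful
    exact simple_whiskeringLeft_obj forgetful S
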